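/- Let $E_{\mathbb R}$ be a real Banach lattice and let $E=E_{\mathbb R}\oplus iE_{\mathbb R}$ be its complexification, a complex Banach lattice with modulus $|x+iy|=\sup_{\theta\in\mathbb R}(x\cos\theta+y\sin\theta)$, norm $\|z\|=\||z|\|$ and positive cone $E_+=(E_{\mathbb R})_+$. Let $(e^{tA})_{t\ge0}$ be a $C_0$-semigroup on $E$ with generator $A$ whose spectral bound $s(A)=\sup\{\operatorname{Re}\lambda:\lambda\in\sigma(A)\}$ satisfies $s(A)>-\infty$ (where $\sup\emptyset=-\infty$). Let $(P_n)_{n\in\mathbb N}$ be a sequence of positive linear operators on $E$ (that is, $P_nE_+\subseteq E_+$) increasing strongly to the identity: $P_nf\le P_{n+1}f$ for all $f\in E_+$ and $n\in\mathbb N$, and $P_nf\to f$ in norm for every $f\in E$. Assume that the semigroup has the LEP (local eventual positivity) property with respect to $(P_n)$: for every $n\in\mathbb N$ and every $f\in E_+\setminus\{0\}$ there exists $\tau>0$ (depending on $n$ and $f$) such that $P_ne^{tA}f\ge0$ for all $t\ge\tau$. Assume further that for every $f\in E$ the orbit $\{e^{t(A-s(A))}f:t\ge0\}$ of the rescaled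 semigroup is relatively compact in $E$ in the norm topology. Then the peripheral point spectrum $\{\lambda\in\sigma(A)\cap\sigma_p(A):\operatorname{Re}\lambda=s(A)\}$, where $\sigma_p(A)$ denotes the set of eigenvalues of $A$, is cyclic: if $a,b\in\mathbb R$ and $a+ib$ belongs to it, then $a+inb$ belongs to it for every $n\in\mathbb Z$. -/

import Mathlib

open Filter Topology Set
open scoped NNReal

/-! ### Complex Banach lattices -/

/-- The underlying set `E ⊕ iE` of the complexification of a real vector space `E`. -/
@[ext]
structure Complexification (E : Type*) where
  /-- the real part of a vector -/
  re : E
  /-- the imaginary part of a vector -/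
  im : E

namespace Complexification

section Algebra

variable {E : Type*} [AddCommGroup E]

instance : Zero (Complexification E) := ⟨⟨0, 0⟩⟩
instance : Add (Complexification E) := ⟨fun z w => ⟨z.re + w.re, z.im + w.im⟩⟩
instance : Neg (Complexification E) := ⟨fun z => ⟨-z.re, -z.im⟩⟩
instance : Sub (Complexification E) := ⟨fun z w => ⟨z.re - w.re, z.im - w.im⟩⟩

@[simp] theorem zero_re : (0 : Complexification E).re = 0 := rfl
@[simp] theorem zero_im : (0 : Complexification E).im = 0 := rfl
@[simp] theorem add_re (z w : Complexification E) : (z + w).re = z.re + w.re := rfl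
@[simp] theorem add_im (z w : Complexification E) : (z + w).im = z.im + w.im := rfl
@[simp] theorem neg_re (z : Complexification E) : (-z).re = -z.re := rfl
@[simp] theorem neg_im (z : Complexification E) : (-z).im = -z.im := rfl
@[simp] theorem sub_re (z w : Complexification E) : (z - w).re = z.re - w.re := rfl
@[simp] theorem sub_im (z w : Complexification E) : (z - w).im = z.im - w.im := rfl

instance : AddCommGroup (Complexification E) where
  add_assoc _ _ _ := by ext <;> simp [add_assoc]
  zero_add _ := by ext <;> simp
  add_zero _ := by ext <;> simp
  add_comm _ _ := by ext <;> simp [add_comm]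
  neg_add_cancel _ := by ext <;> simp
  sub_eq_add_neg _ _ := by ext <;> simp [sub_eq_add_neg]
  nsmul := nsmulRec
  zsmul := zsmulRec

variable [Module ℝ E]

instance : SMul ℂ (Complexification E) :=
  ⟨fun c z => ⟨c.re • z.re - c.im • z.im, c.re • z.im + c.im • z.re⟩⟩

@[simp] theorem smul_re (c : ℂ) (z : Complexification E) :
    (c • z).re = c.re • z.re - c.im • z.im := rfl
@[simp] theorem smul_im (c : ℂ) (z : Complexification E) :
    (c • z).im = c.re • z.im + c.im • z.re := rfl

instance : Module ℂ (Complexification E) where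
  one_smul _ := by ext <;> simp
  mul_smul _ _ _ := by
    ext <;> simp only [smul_re, smul_im, Complex.mul_re, Complex.mul_im] <;> module
  smul_zero _ := by ext <;> simp
  smul_add _ _ _ := by ext <;> simp only [smul_re, smul_im, add_re, add_im] <;> module
  add_smul _ _ _ := by
    ext <;> simp only [smul_re, smul_im, add_re, add_im, Complex.add_re, Complex.add_im] <;> module
  zero_smul _ := by ext <;> simp

end Algebra

/-- The order of the complexification: `z ≤ w` iff `w - z` belongs to the positive cone of the
real part `E`. In particular `0 ≤ z` means that `z` is real and positive in `E`. -/
instance {E : Type*} [PartialOrder E] : PartialOrder (Complexification E) where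
  le z w := z.re ≤ w.re ∧ z.im = w.im
  le_refl _ := ⟨le_rfl, rfl⟩
  le_trans _ _ _ h k := ⟨h.1.trans k.1, h.2.trans k.2⟩
  le_antisymm _ _ h k := Complexification.ext (h.1.antisymm k.1) h.2

theorem le_def {E : Type*} [PartialOrder E] {z w : Complexification E} :
    z ≤ w ↔ z.re ≤ w.re ∧ z.im = w.im := Iff.rfl

section Lattice

variable {E : Type*} [NormedAddCommGroup E] [Lattice E] [HasSolidNorm E] [IsOrderedAddMonoid E]
  [NormedSpace ℝ E] [IsOrderedModule ℝ E]

/-- The element `Re (e^{-iθ} z) = (cos θ) Re z + (sin θ) Im z` of `E`. -/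
noncomputable def rotRe (z : Complexification E) (θ : ℝ) : E :=
  Real.cos θ • z.re + Real.sin θ • z.im

theorem smul_le_abs_smul_abs (a : ℝ) (x : E) : a • x ≤ |a| • |x| := by
  rcases le_total 0 a with ha | ha
  · rw [abs_of_nonneg ha]
    exact smul_le_smul_of_nonneg_left (le_abs_self x) ha
  · rw [abs_of_nonpos ha, ← neg_smul_neg]
    exact smul_le_smul_of_nonneg_left (neg_le_abs x) (neg_nonneg.2 ha)

theorem rotRe_le_add (z : Complexification E) (θ θ' : ℝ) :
    rotRe z θ ≤ rotRe z θ' + |θ - θ'| • (|z.re| + |z.im|) := by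
  have hc : |Real.cos θ - Real.cos θ'| ≤ |θ - θ'| := by
    simpa [Real.dist_eq] using (Real.lipschitzWith_cos.dist_le_mul θ θ')
  have hs : |Real.sin θ - Real.sin θ'| ≤ |θ - θ'| := by
    simpa [Real.dist_eq] using (Real.lipschitzWith_sin.dist_le_mul θ θ')
  have h1 : (Real.cos θ - Real.cos θ') • z.re ≤ |θ - θ'| • |z.re| :=
    (smul_le_abs_smul_abs _ _).trans (smul_le_smul_of_nonneg_right hc (abs_nonneg _))
  have h2 : (Real.sin θ - Real.sin θ') • z.im ≤ |θ - θ'| • |z.im| :=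
    (smul_le_abs_smul_abs _ _).trans (smul_le_smul_of_nonneg_right hs (abs_nonneg _))
  have h3 : rotRe z θ = rotRe z θ' +
      ((Real.cos θ - Real.cos θ') • z.re + (Real.sin θ - Real.sin θ') • z.im) := by
    simp only [rotRe]; module
  rw [h3, smul_add]
  exact add_le_add_right (add_le_add h1 h2) _

/-- Uniform approximation of the family `rotRe z` by finite suprema. -/
theorem exists_approx (z : Complexification E) {ε : ℝ} (hε : 0 < ε) :
    ∃ s : E, (∀ b, (∀ θ, rotRe z θ ≤ b) → s ≤ b) ∧
      ∀ θ, rotRe z θ ≤ s + ε • (|z.re| + |z.im|) := by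
  obtain ⟨t, -, htfin, htcov⟩ :=
    (isCompact_Icc (a := (0 : ℝ)) (b := 2 * Real.pi)).finite_cover_balls hε
  lift t to Finset ℝ using htfin
  have hw : 0 ≤ |z.re| + |z.im| := add_nonneg (abs_nonneg _) (abs_nonneg _)
  have hne : t.Nonempty := by
    have h0 : (0 : ℝ) ∈ ⋃ x ∈ (t : Set ℝ), Metric.ball x ε :=
      htcov ⟨le_rfl, by positivity⟩
    simp only [mem_iUnion] at h0
    obtain ⟨x, hx, -⟩ := h0
    exact ⟨x, hx⟩
  refine ⟨t.sup' hne (rotRe z), fun b hb => Finset.sup'_le _ _ fun θ _ => hb θ, fun θ => ?_⟩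
  obtain ⟨φ, hφ, hφθ⟩ : ∃ φ ∈ Icc (0 : ℝ) (2 * Real.pi), rotRe z θ = rotRe z φ := by
    have hper : Function.Periodic (rotRe z) (2 * Real.pi) := fun θ => by simp [rotRe]
    obtain ⟨φ, hφ, h⟩ := hper.exists_mem_Ico₀ Real.two_pi_pos θ
    exact ⟨φ, Ico_subset_Icc_self hφ, h⟩
  have h1 := htcov hφ
  simp only [mem_iUnion] at h1
  obtain ⟨ψ, hψ, hd⟩ := h1
  rw [Metric.mem_ball, Real.dist_eq] at hd
  rw [hφθ]
  refine (rotRe_le_add z φ ψ).trans ?_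
  exact add_le_add (Finset.le_sup' (rotRe z) hψ) (smul_le_smul_of_nonneg_right hd.le hw)

/-- In a Banach lattice, the supremum of all `Re (e^{-iθ} z)`, `θ ∈ ℝ`, exists. -/
theorem exists_isLUB_rotRe [CompleteSpace E] (z : Complexification E) :
    ∃ m : E, IsLUB (range (rotRe z)) m := by
  have hpos : ∀ n : ℕ, (0 : ℝ) < 1 / ((n : ℝ) + 1) := fun n => Nat.one_div_pos_of_nat
  choose s hs1 hs2 using fun n : ℕ => exists_approx z (hpos n)
  set w : E := |z.re| + |z.im| with hwdef
  have hw : 0 ≤ w := add_nonneg (abs_nonneg _) (abs_nonneg _)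
  have hle : ∀ m n : ℕ, s m ≤ s n + (1 / ((n : ℝ) + 1)) • w := fun m n => hs1 m _ (hs2 n)
  have hcau : CauchySeq s := by
    refine cauchySeq_of_le_tendsto_0 (fun N : ℕ => (1 / ((N : ℝ) + 1)) * ‖w‖) ?_ ?_
    · intro n m N hn hm
      have key : ∀ k l : ℕ, N ≤ l → s k - s l ≤ (1 / ((N : ℝ) + 1)) • w := by
        intro k l hl
        refine (sub_le_iff_le_add'.2 (hle k l)).trans ?_
        exact smul_le_smul_of_nonneg_right (one_div_le_one_div_of_le (by positivity)
          (by exact_mod_cast Nat.succ_le_succ hl)) hw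
      have habs : |s n - s m| ≤ |(1 / ((N : ℝ) + 1)) • w| := by
        rw [abs_of_nonneg (smul_nonneg (hpos N).le hw)]
        refine abs_le'.2 ⟨key n m hm, ?_⟩
        rw [neg_sub]
        exact key m n hn
      rw [dist_eq_norm]
      refine (norm_le_norm_of_abs_le_abs habs).trans ?_
      rw [norm_smul, Real.norm_of_nonneg (hpos N).le]
    · simpa using tendsto_one_div_add_atTop_nhds_zero_nat.mul_const ‖w‖
  obtain ⟨m, hm⟩ := cauchySeq_tendsto_of_complete hcau
  refine ⟨m, ?_, ?_⟩
  · rintro _ ⟨θ, rfl⟩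
    have hlim : Tendsto (fun n : ℕ => s n + (1 / ((n : ℝ) + 1)) • w) atTop (𝓝 m) := by
      simpa using hm.add ((tendsto_one_div_add_atTop_nhds_zero_nat (𝕜 := ℝ)).smul_const w)
    exact ge_of_tendsto' hlim fun n => hs2 n θ
  · intro b hb
    exact le_of_tendsto' hm fun n => hs1 n b fun θ => hb ⟨θ, rfl⟩

variable [CompleteSpace E]

/-- The modulus `|z| = sup_θ Re (e^{-iθ} z)` of `z ∈ E ⊕ iE`. -/
noncomputable def modulus (z : Complexification E) : E := (exists_isLUB_rotRe z).choose

theorem isLUB_modulus (z : Complexification E) : IsLUB (range (rotRe z)) (modulus z) :=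
  (exists_isLUB_rotRe z).choose_spec

theorem rotRe_le_modulus (z : Complexification E) (θ : ℝ) : rotRe z θ ≤ modulus z :=
  (isLUB_modulus z).1 ⟨θ, rfl⟩

theorem modulus_le {z : Complexification E} {b : E} (h : ∀ θ, rotRe z θ ≤ b) : modulus z ≤ b :=
  (isLUB_modulus z).2 (by rintro _ ⟨θ, rfl⟩; exact h θ)

theorem abs_rotRe_le_modulus (z : Complexification E) (θ : ℝ) : |rotRe z θ| ≤ modulus z := by
  refine abs_le'.2 ⟨rotRe_le_modulus z θ, ?_⟩
  have h : -rotRe z θ = rotRe z (θ + Real.pi) := by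
    simp only [rotRe, Real.cos_add_pi, Real.sin_add_pi]; module
  rw [h]
  exact rotRe_le_modulus z _

theorem modulus_nonneg (z : Complexification E) : 0 ≤ modulus z :=
  (abs_nonneg _).trans (abs_rotRe_le_modulus z 0)

theorem abs_re_le_modulus (z : Complexification E) : |z.re| ≤ modulus z := by
  simpa [rotRe] using abs_rotRe_le_modulus z 0

theorem abs_im_le_modulus (z : Complexification E) : |z.im| ≤ modulus z := by
  simpa [rotRe] using abs_rotRe_le_modulus z (Real.pi / 2)

theorem modulus_le_abs_add_abs (z : Complexification E) : modulus z ≤ |z.re| + |z.im| := by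
  refine modulus_le fun θ => add_le_add ?_ ?_
  · refine (smul_le_abs_smul_abs _ _).trans ?_
    simpa using smul_le_smul_of_nonneg_right (Real.abs_cos_le_one θ) (abs_nonneg z.re)
  · refine (smul_le_abs_smul_abs _ _).trans ?_
    simpa using smul_le_smul_of_nonneg_right (Real.abs_sin_le_one θ) (abs_nonneg z.im)

theorem modulus_add_le (z w : Complexification E) : modulus (z + w) ≤ modulus z + modulus w := by
  refine modulus_le fun θ => ?_
  have h : rotRe (z + w) θ = rotRe z θ + rotRe w θ := by
    simp only [rotRe, add_re, add_im]; module
  rw [h]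
  exact add_le_add (rotRe_le_modulus z θ) (rotRe_le_modulus w θ)

theorem modulus_smul_le (c : ℂ) (z : Complexification E) : modulus (c • z) ≤ ‖c‖ • modulus z := by
  refine modulus_le fun θ => ?_
  have h : rotRe (c • z) θ = ‖c‖ • rotRe z (θ - c.arg) := by
    simp only [rotRe, smul_re, smul_im, Real.cos_sub, Real.sin_sub]
    conv_lhs => rw [← Complex.norm_mul_cos_arg c, ← Complex.norm_mul_sin_arg c]
    module
  rw [h]
  exact smul_le_smul_of_nonneg_left (rotRe_le_modulus z _) (norm_nonneg c)

theorem modulus_zero : modulus (0 : Complexification E) = 0 :=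
  le_antisymm (by simpa using modulus_le_abs_add_abs (0 : Complexification E)) (modulus_nonneg _)

theorem modulus_neg_le (z : Complexification E) : modulus (-z) ≤ modulus z := by
  simpa using modulus_smul_le (-1) z

theorem norm_le_norm_of_le {x y : E} (hx : 0 ≤ x) (h : x ≤ y) : ‖x‖ ≤ ‖y‖ :=
  norm_le_norm_of_abs_le_abs (by rwa [abs_of_nonneg hx, abs_of_nonneg (hx.trans h)])

/-- The norm `‖z‖ = ‖|z|‖` of the complexification of a Banach lattice. -/
noncomputable instance : NormedAddCommGroup (Complexification E) :=
  AddGroupNorm.toNormedAddCommGroup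
    { toFun := fun z => ‖modulus z‖
      map_zero' := by rw [modulus_zero, norm_zero]
      add_le' := fun z w =>
        (norm_le_norm_of_le (modulus_nonneg _) (modulus_add_le z w)).trans (norm_add_le _ _)
      neg' := fun z => by
        refine le_antisymm (norm_le_norm_of_le (modulus_nonneg _) (modulus_neg_le z))
          (norm_le_norm_of_le (modulus_nonneg _) ?_)
        simpa using modulus_neg_le (-z)
      eq_zero_of_map_eq_zero' := fun z hz => by
        have hz' : modulus z = 0 := norm_eq_zero.1 hz
        have h1 : ‖z.re‖ ≤ 0 := by
          rw [← norm_abs_eq_norm, ← hz]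
          exact norm_le_norm_of_le (abs_nonneg _) (abs_re_le_modulus z)
        have h2 : ‖z.im‖ ≤ 0 := by
          rw [← norm_abs_eq_norm, ← hz]
          exact norm_le_norm_of_le (abs_nonneg _) (abs_im_le_modulus z)
        ext
        · exact norm_le_zero_iff.1 h1
        · exact norm_le_zero_iff.1 h2 }

theorem norm_def (z : Complexification E) : ‖z‖ = ‖modulus z‖ := rfl

noncomputable instance : NormedSpace ℂ (Complexification E) where
  norm_smul_le c z := by
    rw [norm_def, norm_def]
    refine (norm_le_norm_of_le (modulus_nonneg _) (modulus_smul_le c z)).trans ?_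
    rw [norm_smul, norm_norm]

theorem norm_re_le (z : Complexification E) : ‖z.re‖ ≤ ‖z‖ := by
  rw [← norm_abs_eq_norm, norm_def]
  exact norm_le_norm_of_le (abs_nonneg _) (abs_re_le_modulus z)

theorem norm_im_le (z : Complexification E) : ‖z.im‖ ≤ ‖z‖ := by
  rw [← norm_abs_eq_norm, norm_def]
  exact norm_le_norm_of_le (abs_nonneg _) (abs_im_le_modulus z)

theorem norm_le_add (z : Complexification E) : ‖z‖ ≤ ‖z.re‖ + ‖z.im‖ := by
  refine (norm_le_norm_of_le (modulus_nonneg _) (modulus_le_abs_add_abs z)).trans ?_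
  simpa [norm_abs_eq_norm] using norm_add_le |z.re| |z.im|

theorem lipschitzWith_re : LipschitzWith 1 (re : Complexification E → E) :=
  LipschitzWith.mk_one fun z w => by
    rw [dist_eq_norm, dist_eq_norm, ← sub_re]
    exact norm_re_le (z - w)

theorem lipschitzWith_im : LipschitzWith 1 (im : Complexification E → E) :=
  LipschitzWith.mk_one fun z w => by
    rw [dist_eq_norm, dist_eq_norm, ← sub_im]
    exact norm_im_le (z - w)

theorem tendsto_of_re_im {u : ℕ → Complexification E} {z : Complexification E}
    (hx : Tendsto (fun n => (u n).re) atTop (𝓝 z.re))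
    (hy : Tendsto (fun n => (u n).im) atTop (𝓝 z.im)) : Tendsto u atTop (𝓝 z) := by
  rw [tendsto_iff_norm_sub_tendsto_zero] at hx hy ⊢
  have h := hx.add hy
  rw [add_zero] at h
  exact squeeze_zero (fun _ => norm_nonneg _) (fun n => norm_le_add (u n - z)) h

instance : CompleteSpace (Complexification E) :=
  Metric.complete_of_cauchySeq_tendsto fun u hu => by
    obtain ⟨x, hx⟩ := cauchySeq_tendsto_of_complete
      (lipschitzWith_re.uniformContinuous.comp_cauchySeq hu)
    obtain ⟨y, hy⟩ := cauchySeq_tendsto_of_complete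
      (lipschitzWith_im.uniformContinuous.comp_cauchySeq hu)
    exact ⟨⟨x, y⟩, tendsto_of_re_im hx hy⟩

end Lattice

end Complexification

/-! ### Strongly continuous semigroups, their generators and spectra -/

/-- A `C₀`-semigroup of bounded linear operators on a complex normed space. -/
structure C0Semigroup (X : Type*) [NormedAddCommGroup X] [NormedSpace ℂ X] where
  /-- the operator at time `t` -/
  op : ℝ≥0 → X →L[ℂ] X
  op_zero : op 0 = ContinuousLinearMap.id ℂ X
  op_add : ∀ s t, op (s + t) = (op s).comp (op t)
  continuous_orbit : ∀ x, Continuous fun t => op t x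

namespace C0Semigroup

variable {X : Type*} [NormedAddCommGroup X] [NormedSpace ℂ X]

/-- `(x, y)` belongs to the graph of the generator: `y = lim_{t ↓ 0} (T(t) x - x) / t`. -/
def IsGeneratorValue (T : C0Semigroup X) (x y : X) : Prop :=
  Tendsto (fun t : ℝ≥0 => ((t : ℝ) : ℂ)⁻¹ • (T.op t x - x)) (𝓝[>] 0) (𝓝 y)

/-- The generator of a `C₀`-semigroup, with its maximal domain. -/
noncomputable def generator (T : C0Semigroup X) : X →ₗ.[ℂ] X where
  domain :=
    { carrier := {x | ∃ y, T.IsGeneratorValue x y}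
      zero_mem' := ⟨0, by simp [IsGeneratorValue]⟩
      add_mem' := by
        rintro x x' ⟨y, hy⟩ ⟨y', hy'⟩
        refine ⟨y + y', (hy.add hy').congr fun t => ?_⟩
        rw [map_add, ← smul_add]; congr 1; abel
      smul_mem' := by
        rintro c x ⟨y, hy⟩
        refine ⟨c • y, (hy.const_smul c).congr fun t => ?_⟩
        rw [map_smul, ← smul_sub, smul_comm] }
  toFun :=
    { toFun := fun x => x.2.choose
      map_add' := fun x x' => by
        refine tendsto_nhds_unique (x + x').2.choose_spec
          ((x.2.choose_spec.add x'.2.choose_spec).congr fun t => ?_)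
        rw [Submodule.coe_add, map_add, ← smul_add]; congr 1; abel
      map_smul' := fun c x => by
        refine tendsto_nhds_unique (c • x).2.choose_spec
          ((x.2.choose_spec.const_smul c).congr fun t => ?_)
        rw [Submodule.coe_smul, map_smul, ← smul_sub, smul_comm] }

/-- The rescaled semigroup `t ↦ e^{-ωt} T(t)`, whose generator is `A - ω`. -/
noncomputable def rescale (T : C0Semigroup X) (ω : ℝ) : C0Semigroup X where
  op t := ((Real.exp (-ω * t) : ℝ) : ℂ) • T.op t
  op_zero := by simp [T.op_zero]
  op_add s t := by
    rw [T.op_add, ContinuousLinearMap.smul_comp, ContinuousLinearMap.comp_smul, smul_smul,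
      ← Complex.ofReal_mul, ← Real.exp_add, NNReal.coe_add, mul_add]
  continuous_orbit x := by
    have h := T.continuous_orbit x
    simp only [smul_apply]
    fun_prop

/-- The orbit `{T(t) x : t ≥ 0}` is relatively compact in norm for every `x`. -/
def HasRelativelyCompactOrbits (T : C0Semigroup X) : Prop :=
  ∀ x, IsCompact (closure (range fun t => T.op t x))

end C0Semigroup

namespace LinearPMap

variable {X : Type*} [NormedAddCommGroup X] [NormedSpace ℂ X]

/-- The resolvent set of an operator `A`: those `μ` for which `μ - A : D(A) → X` is a bijection
with bounded inverse `R`. -/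
def unboundedResolventSet (A : X →ₗ.[ℂ] X) : Set ℂ :=
  {μ | ∃ R : X →L[ℂ] X,
    (∀ x : X, ∃ h : R x ∈ A.domain, μ • R x - A ⟨R x, h⟩ = x) ∧
    ∀ x : A.domain, R (μ • (x : X) - A x) = x}

/-- The spectrum `σ(A)`. -/
def unboundedSpectrum (A : X →ₗ.[ℂ] X) : Set ℂ := A.unboundedResolventSetᶜ

/-- The point spectrum `σ_p(A)`, i.e. the set of eigenvalues of `A`. -/
def pointSpectrum (A : X →ₗ.[ℂ] X) : Set ℂ :=
  {μ | ∃ x : A.domain, (x : X) ≠ 0 ∧ A x = μ • (x : X)}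

/-- The spectral bound `s(A) = sup {Re μ : μ ∈ σ(A)} ∈ [-∞, ∞]`, with `sup ∅ = -∞`. -/
noncomputable def spectralBound (A : X →ₗ.[ℂ] X) : EReal :=
  sSup ((fun μ : ℂ => (μ.re : EReal)) '' A.unboundedSpectrum)

/-- The peripheral spectrum `{μ ∈ σ(A) : Re μ = s(A)}`. -/
def peripheralSpectrum (A : X →ₗ.[ℂ] X) : Set ℂ :=
  {μ | μ ∈ A.unboundedSpectrum ∧ (μ.re : EReal) = A.spectralBound}

/-- The peripheral point spectrum. -/
def peripheralPointSpectrum (A : X →ₗ.[ℂ] X) : Set ℂ :=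
  A.peripheralSpectrum ∩ A.pointSpectrum

end LinearPMap

/-- A set `S ⊆ ℂ` is cyclic if `a + ib ∈ S` implies `a + inb ∈ S` for all integers `n`. -/
def IsCyclicSet (S : Set ℂ) : Prop :=
  ∀ a b : ℝ, (a : ℂ) + Complex.I * b ∈ S → ∀ n : ℤ, (a : ℂ) + Complex.I * (n * b) ∈ S

/-! ### Local eventual positivity -/

section LEP

variable {E : Type*} [NormedAddCommGroup E] [Lattice E] [HasSolidNorm E] [IsOrderedAddMonoid E]
  [NormedSpace ℝ E] [IsOrderedModule ℝ E] [CompleteSpace E]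

/-- The `P n` are positive operators that increase strongly to the identity. -/
structure IncreasesStronglyToId
    (P : ℕ → Complexification E →ₗ[ℂ] Complexification E) : Prop where
  pos : ∀ n f, 0 ≤ f → 0 ≤ P n f
  mono : ∀ n f, 0 ≤ f → P n f ≤ P (n + 1) f
  tendsto : ∀ f, Tendsto (fun n => P n f) atTop (𝓝 f)

/-- The LEP (local eventual positivity) property with respect to `(P n)`. -/
def HasLEP (T : C0Semigroup (Complexification E))
    (P : ℕ → Complexification E →ₗ[ℂ] Complexification E) : Prop :=
  ∀ n f, 0 ≤ f → f ≠ 0 → ∃ τ : ℝ≥0, 0 < τ ∧ ∀ t, τ ≤ t → 0 ≤ P n (T.op t f)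

end LEP

/-! After rescaling, the eigenvector `z` has a purely imaginary eigenvalue `ib`, and for `b ≠ 0` it
is fixed by `T(p)` with `p = 2π/|b|`. Averaging `T(kp)` over windows of `k` that move to infinity
gives a projection `M` onto the fixed space of `T(p)` (`exists_ergodic_projection`). Only large
times enter the limit, so local eventual positivity, followed by `P n → id`, makes `M` positive. On
the range of `M` time may be shifted by multiples of `p`, so there the semigroup is a periodic group
of positive operators.

The range of `M` need not be a sublattice, but in its own order it is a vector lattice in which `x`
has positive part `M x⁺`. The group respects this structure and rotates `z`. Hence it translates in
`φ` the function `peak`, the positive part of `Re (e^{-iφ} z) - c M|z|` in that lattice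
(`apply_peak`), and every Fourier coefficient of this function is an eigenvector for a multiple of
`ib` (`op_fourierCoeff_eq`).

It remains to see that the `n`-th coefficient is nonzero. For `c < 1` close to `1`, peaks at distant
angles are disjoint in the range of `M` (`map_peak_inf_peak_eq_zero`), while some peak does not
vanish (`exists_peak_ne_zero`). Centre at that angle: where `cos (nφ)` may be small or negative, the
integrand lies in the closed ideal of vectors disjoint from the central peak modulo `M`. A zero
coefficient would force the central peak itself into this ideal (`integral_cos_smul_ne_zero`). -/

set_option linter.unusedSectionVars false

/-! ### Mean ergodic projections of a semigroup. -/

namespace C0Semigroup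

variable {X : Type*} [NormedAddCommGroup X] [NormedSpace ℂ X]

theorem exists_norm_op_le [CompleteSpace X] (T : C0Semigroup X)
    (hT : T.HasRelativelyCompactOrbits) : ∃ C : ℝ, ∀ t, ‖T.op t‖ ≤ C := by
  refine banach_steinhaus fun x => ?_
  obtain ⟨C, hC⟩ := ((hT x).isBounded.subset subset_closure).exists_norm_le
  exact ⟨C, fun t => hC _ ⟨t, rfl⟩⟩

theorem op_nsmul_apply_of_fixed (T : C0Semigroup X) {p : ℝ≥0} {x : X} (hx : T.op p x = x)
    (k : ℕ) : T.op (k • p) x = x := by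
  induction k with
  | zero => simp [T.op_zero]
  | succ k ih => rw [succ_nsmul, T.op_add, ContinuousLinearMap.comp_apply, hx, ih]

theorem op_comm_apply (T : C0Semigroup X) (s t : ℝ≥0) (x : X) :
    T.op s (T.op t x) = T.op t (T.op s x) := by
  rw [← ContinuousLinearMap.comp_apply, ← ContinuousLinearMap.comp_apply, ← T.op_add,
    ← T.op_add, add_comm]

/-- The averages of `T(kp)`, `N ≤ k ≤ 2N`. -/
noncomputable def windowAverage (T : C0Semigroup X) (p : ℝ≥0) (N : ℕ) : X →L[ℂ] X :=
  ∑ k ∈ Finset.range (N + 1), (((1 / ((N : ℝ) + 1) : ℝ)) : ℂ) • T.op ((N + k) • p)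

theorem windowAverage_apply (T : C0Semigroup X) (p : ℝ≥0) (N : ℕ) (x : X) :
    T.windowAverage p N x =
      ∑ k ∈ Finset.range (N + 1), (1 / ((N : ℝ) + 1)) • T.op ((N + k) • p) x := by
  simp only [windowAverage, sum_apply, smul_apply, Complex.coe_smul]

/-- The average is a convex combination of terms with index at least `N`. Convex properties that
hold for all late times therefore survive in the limit. -/
theorem windowAverage_mem (T : C0Semigroup X) (p : ℝ≥0) (N : ℕ) {x : X} {C : Set X}
    (hC : Convex ℝ C) (h : ∀ k, N ≤ k → T.op (k • p) x ∈ C) : T.windowAverage p N x ∈ C := by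
  rw [windowAverage_apply]
  refine hC.sum_mem (fun _ _ => by positivity) ?_ fun k _ => h _ (Nat.le_add_right _ _)
  have : (N : ℝ) + 1 ≠ 0 := by positivity
  simp [this]

theorem op_windowAverage_sub (T : C0Semigroup X) (p : ℝ≥0) (N : ℕ) (x : X) :
    T.op p (T.windowAverage p N x) - T.windowAverage p N x =
      (1 / ((N : ℝ) + 1)) • (T.op ((N + (N + 1)) • p) x - T.op (N • p) x) := by
  have h : ∀ k : ℕ, T.op p (T.op (k • p) x) = T.op ((k + 1) • p) x := fun k => by
    rw [succ_nsmul', T.op_add, ContinuousLinearMap.comp_apply]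
  have h2 : T.op p (T.windowAverage p N x) =
      ∑ k ∈ Finset.range (N + 1), (1 / ((N : ℝ) + 1)) • T.op ((N + (k + 1)) • p) x := by
    simp only [windowAverage, sum_apply, smul_apply, map_sum, map_smul, h,
      ← Complex.coe_smul]
    rfl
  rw [h2, windowAverage_apply, ← Finset.smul_sum, ← Finset.smul_sum, ← smul_sub,
    ← Finset.sum_sub_distrib, Finset.sum_range_sub (fun k => T.op ((N + k) • p) x), add_zero]

/-- A mean ergodic projection onto the fixed space of `T(p)`. Its values are limits of averages of
`T(kp)` with large `k`. -/
theorem exists_ergodic_projection [CompleteSpace X] (T : C0Semigroup X)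
    (hT : T.HasRelativelyCompactOrbits) (p : ℝ≥0) :
    ∃ M : X →L[ℂ] X, (∀ x, T.op p (M x) = M x) ∧ (∀ x, T.op p x = x → M x = x) ∧
      (∀ t x, T.op t (M x) = M (T.op t x)) ∧
      ∀ (C : Set X) (x : X), IsClosed C → Convex ℝ C → (∀ᶠ k : ℕ in atTop, T.op (k • p) x ∈ C) →
        M x ∈ C := by
  obtain ⟨C, hC⟩ := T.exists_norm_op_le hT
  -- The closed convex hull of a relatively compact orbit is compact, so one fixed ultrafilter makes
  -- the averages converge for every `x`. Using the same filter for all `x` makes the limit linear.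
  have hlim : ∀ x, ∃ y, Tendsto (fun N => T.windowAverage p N x)
      ((hyperfilter ℕ : Ultrafilter ℕ) : Filter ℕ) (𝓝 y) := fun x => by
    set K := closure (convexHull ℝ (closure (range fun t => T.op t x))) with hK
    have hKc : IsCompact K := TotallyBounded.isCompact_of_isClosed
      ((hT x).totallyBounded.convexHull.closure) isClosed_closure
    have hmem : ∀ N, T.windowAverage p N x ∈ K := fun N =>
      subset_closure (T.windowAverage_mem p N (convex_convexHull ℝ _) fun k _ =>
        subset_convexHull ℝ _ (subset_closure ⟨_, rfl⟩))
    obtain ⟨y, -, hy⟩ := hKc.ultrafilter_le_nhds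
      ((hyperfilter ℕ).map fun N => T.windowAverage p N x)
      (by
        rw [le_principal_iff]
        exact Filter.Eventually.of_forall (f := (hyperfilter ℕ : Filter ℕ)) hmem)
    exact ⟨y, hy⟩
  choose M hM using hlim
  have hC0 : 0 ≤ C := (norm_nonneg _).trans (hC 0)
  have hle : ((hyperfilter ℕ : Ultrafilter ℕ) : Filter ℕ) ≤ atTop := Nat.hyperfilter_le_atTop
  have hbound : ∀ N x, ‖T.windowAverage p N x‖ ≤ C * ‖x‖ := fun N x => by
    have := T.windowAverage_mem p N (x := x) (convex_closedBall (0 : X) (C * ‖x‖)) fun k _ => by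
      rw [mem_closedBall_zero_iff]
      exact ((T.op _).le_opNorm x).trans (mul_le_mul_of_nonneg_right (hC _) (norm_nonneg _))
    rwa [mem_closedBall_zero_iff] at this
  let M' : X →ₗ[ℂ] X :=
    { toFun := M
      map_add' := fun x y => tendsto_nhds_unique (hM (x + y))
        (((hM x).add (hM y)).congr fun N => (map_add _ _ _).symm)
      map_smul' := fun c x => tendsto_nhds_unique (hM (c • x))
        (((hM x).const_smul c).congr fun N => (map_smul _ _ _).symm) }
  refine ⟨M'.mkContinuous C fun x => le_of_tendsto' (hM x).norm fun N => hbound N x,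
    fun x => ?_, fun x hx => ?_, fun t x => ?_, fun K x hK hKc h => ?_⟩
  -- The difference telescopes to two bounded terms divided by `N + 1`.
  · have h1 := (((T.op p).continuous.tendsto _).comp (hM x)).sub (hM x)
    have h2 : Tendsto (fun N : ℕ => T.op p (T.windowAverage p N x) - T.windowAverage p N x)
        atTop (𝓝 0) := by
      have h3 : Tendsto (fun N : ℕ => (1 / ((N : ℝ) + 1)) * (C * ‖x‖ + C * ‖x‖)) atTop (𝓝 0) := by
        simpa using
          (tendsto_one_div_add_atTop_nhds_zero_nat (𝕜 := ℝ)).mul_const (C * ‖x‖ + C * ‖x‖)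
      refine squeeze_zero_norm (fun N => ?_) h3
      have hb : ∀ t, ‖T.op t x‖ ≤ C * ‖x‖ := fun t =>
        ((T.op _).le_opNorm x).trans (mul_le_mul_of_nonneg_right (hC _) (norm_nonneg _))
      rw [op_windowAverage_sub, norm_smul, Real.norm_of_nonneg (by positivity)]
      exact mul_le_mul_of_nonneg_left ((norm_sub_le _ _).trans (add_le_add (hb _) (hb _)))
        (by positivity)
    exact sub_eq_zero.1 (tendsto_nhds_unique h1 (h2.mono_left hle))
  · refine tendsto_nhds_unique (hM x) (tendsto_const_nhds.congr fun N => ?_)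
    exact (mem_singleton_iff.1 (T.windowAverage_mem p N (convex_singleton x)
      fun k _ => T.op_nsmul_apply_of_fixed hx k)).symm
  · refine tendsto_nhds_unique (((T.op t).continuous.tendsto _).comp (hM x))
      ((hM (T.op t x)).congr fun N => ?_)
    simp only [Function.comp_apply, windowAverage, sum_apply, smul_apply, map_sum, map_smul,
      T.op_comm_apply t]
  · obtain ⟨N₀, hN₀⟩ := eventually_atTop.1 h
    refine hK.mem_of_tendsto (hM x) ((?_ : ∀ᶠ N in atTop, T.windowAverage p N x ∈ K).filter_mono hle)
    filter_upwards [eventually_ge_atTop N₀] with N hN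
    exact T.windowAverage_mem p N hKc fun k hk => hN₀ k (hN.trans hk)

/-! ### Eigenvectors of the generator and of the semigroup. -/

theorem generator_apply_eq (T : C0Semigroup X) {x y : X} (h : T.IsGeneratorValue x y) :
    T.generator ⟨x, ⟨y, h⟩⟩ = y :=
  tendsto_nhds_unique (Exists.choose_spec (⟨y, h⟩ : ∃ y, T.IsGeneratorValue x y)) h

theorem isGeneratorValue_generator (T : C0Semigroup X) (x : T.generator.domain) :
    T.IsGeneratorValue x (T.generator x) :=
  x.2.choose_spec

/-- An eigenvector of all operators of the semigroup is an eigenvector of the generator. -/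
theorem mem_pointSpectrum_of_op_eq (T : C0Semigroup X) {μ : ℂ} {x : X} (hx : x ≠ 0)
    (h : ∀ t : ℝ≥0, T.op t x = Complex.exp (μ * (t : ℝ)) • x) :
    μ ∈ T.generator.pointSpectrum := by
  have hv : T.IsGeneratorValue x (μ • x) := by
    have hd : HasDerivAt (fun t : ℝ => Complex.exp (μ * t)) μ 0 := by
      simpa using (((hasDerivAt_id (0 : ℝ)).ofReal_comp).const_mul μ).cexp
    have h1 := hd.tendsto_slope_zero_right
    have h2 : Tendsto (fun t : ℝ≥0 => (t : ℝ)) (𝓝[>] 0) (𝓝[>] 0) := by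
      refine tendsto_nhdsWithin_iff.2 ⟨?_, ?_⟩
      · exact (NNReal.continuous_coe.tendsto' 0 0 rfl).mono_left nhdsWithin_le_nhds
      · filter_upwards [self_mem_nhdsWithin] with t ht
        exact NNReal.coe_pos.2 ht
    refine ((h1.comp h2).smul_const x).congr fun t => ?_
    simp only [Function.comp_apply, zero_add, Complex.ofReal_zero, mul_zero, Complex.exp_zero, h t,
      sub_smul, one_smul, smul_assoc]
    rw [← Complex.coe_smul, Complex.ofReal_inv]
  exact ⟨⟨x, ⟨_, hv⟩⟩, hx, T.generator_apply_eq hv⟩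

/-- An eigenvector of the generator is an eigenvector of all operators of the semigroup. -/
theorem op_eq_of_generator_eq (T : C0Semigroup X) {μ : ℂ} (x : T.generator.domain)
    (h : T.generator x = μ • (x : X)) (t : ℝ≥0) :
    T.op t x = Complex.exp (μ * (t : ℝ)) • (x : X) := by
  have hv : T.IsGeneratorValue x (μ • (x : X)) := h ▸ T.isGeneratorValue_generator x
  -- The function `e^{-μs} T(s) x` has right derivative zero, hence is constant. Right derivatives
  -- suffice and are all that the definition of the generator supplies directly.
  set u : ℝ → X := fun s => Complex.exp (-(μ * s)) • T.op s.toNNReal x with hu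
  have hcont : Continuous u := by
    have := (T.continuous_orbit x).comp continuous_real_toNNReal
    simp only [Function.comp_def] at this
    fun_prop
  have hder : ∀ s ∈ Ico (0 : ℝ) t, HasDerivWithinAt u 0 (Ici s) s := by
    intro s hs
    have h1 : HasDerivWithinAt (fun r : ℝ => T.op r.toNNReal (x : X))
        (μ • T.op s.toNNReal x) (Ici s) s := by
      rw [← hasDerivWithinAt_Ioi_iff_Ici, hasDerivWithinAt_iff_tendsto_slope' (by simp)]
      have h2 : Tendsto (fun r : ℝ => (r - s).toNNReal) (𝓝[>] s) (𝓝[>] 0) := by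
        refine tendsto_nhdsWithin_iff.2 ⟨?_, ?_⟩
        · have : Continuous fun r : ℝ => (r - s).toNNReal := by fun_prop
          exact (this.tendsto' s 0 (by simp)).mono_left nhdsWithin_le_nhds
        · filter_upwards [self_mem_nhdsWithin] with r hr
          exact Real.toNNReal_pos.2 (sub_pos.2 hr)
      have h3 := ((T.op s.toNNReal).continuous.tendsto _).comp (hv.comp h2)
      rw [map_smul] at h3
      refine h3.congr' ?_
      filter_upwards [self_mem_nhdsWithin] with r hr
      have hrs : 0 ≤ r - s := (sub_pos.2 hr).le
      have h4 : r.toNNReal = s.toNNReal + (r - s).toNNReal := by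
        rw [← Real.toNNReal_add hs.1 hrs]; congr 1; ring
      simp only [Function.comp_apply, slope_def_module, map_smul, map_sub]
      rw [h4, T.op_add, ContinuousLinearMap.comp_apply, Real.coe_toNNReal _ hrs,
        ← Complex.ofReal_inv, Complex.coe_smul]
    have h5 : HasDerivWithinAt (fun r : ℝ => Complex.exp (-(μ * r)))
        (Complex.exp (-(μ * s)) * (-μ)) (Ici s) s := by
      have : HasDerivAt (fun r : ℝ => -(μ * (r : ℂ))) (-μ) s := by
        simpa using (((hasDerivAt_id s).ofReal_comp).const_mul μ).fun_neg
      exact this.cexp.hasDerivWithinAt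
    refine (h5.smul h1).congr_deriv ?_
    rw [mul_smul, neg_smul, smul_neg]
    simp
  have hc := constant_of_has_deriv_right_zero hcont.continuousOn hder t ⟨t.2, le_rfl⟩
  simp only [hu, Real.toNNReal_coe, Real.toNNReal_zero, T.op_zero, Complex.ofReal_zero, mul_zero,
    neg_zero, Complex.exp_zero, one_smul, ContinuousLinearMap.id_apply] at hc
  calc T.op t x = (Complex.exp (μ * (t : ℝ)) * Complex.exp (-(μ * (t : ℝ)))) • T.op t (x : X) := by
        rw [← Complex.exp_add, add_neg_cancel, Complex.exp_zero, one_smul]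
    _ = Complex.exp (μ * (t : ℝ)) • (x : X) := by rw [mul_smul, hc]

end C0Semigroup

theorem LinearPMap.pointSpectrum_subset_unboundedSpectrum {X : Type*} [NormedAddCommGroup X]
    [NormedSpace ℂ X] (A : X →ₗ.[ℂ] X) : A.pointSpectrum ⊆ A.unboundedSpectrum := by
  rintro μ ⟨x, hx, hAx⟩ ⟨R, -, hR⟩
  exact hx (by rw [← hR x, hAx, sub_self]; exact ContinuousLinearMap.map_zero R)

/-! ### Disjointness and positive parts relative to a positive projection. -/

section PositiveProjection

variable {E : Type*} [NormedAddCommGroup E] [Lattice E] [HasSolidNorm E] [IsOrderedAddMonoid E]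
  [NormedSpace ℝ E] [IsOrderedModule ℝ E]

theorem add_inf_le_inf_add_inf {α : Type*} [AddCommGroup α] [Lattice α] [IsOrderedAddMonoid α]
    {a b y : α} (ha : 0 ≤ a) (hb : 0 ≤ b) (hy : 0 ≤ y) : (a + b) ⊓ y ≤ a ⊓ y + b ⊓ y := by
  rw [add_inf, inf_add, inf_add]
  refine le_inf (le_inf inf_le_left ?_) (le_inf ?_ ?_)
  · exact inf_le_right.trans (le_add_of_nonneg_right hb)
  · exact inf_le_right.trans (le_add_of_nonneg_left ha)
  · exact inf_le_right.trans (le_add_of_nonneg_right hy)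

theorem abs_smul_le_abs_smul_abs (a : ℝ) (x : E) : |a • x| ≤ |a| • |x| := by
  refine abs_le'.2 ⟨Complexification.smul_le_abs_smul_abs a x, ?_⟩
  simpa using Complexification.smul_le_abs_smul_abs (-a) x

/-- The factor `r + 1` exceeds both `r` and `1`, so dividing by it brings the left side below `a`
and below `y` at once. This gives closure of `disjointSubmodule` under scalars. -/
theorem smul_inf_le_smul_inf {r : ℝ} (hr : 0 ≤ r) {a y : E} (ha : 0 ≤ a) (hy : 0 ≤ y) :
    (r • a) ⊓ y ≤ (r + 1) • (a ⊓ y) := by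
  have hr1 : 0 < r + 1 := by linarith
  have ht : (r + 1)⁻¹ • ((r • a) ⊓ y) ≤ a ⊓ y := by
    refine le_inf ?_ ?_
    · calc (r + 1)⁻¹ • ((r • a) ⊓ y) ≤ (r + 1)⁻¹ • (r • a) :=
            smul_le_smul_of_nonneg_left inf_le_left (inv_nonneg.2 hr1.le)
        _ = ((r + 1)⁻¹ * r) • a := smul_smul _ _ _
        _ ≤ (1 : ℝ) • a := smul_le_smul_of_nonneg_right (by
            rw [inv_mul_le_iff₀ hr1]; linarith) ha
        _ = a := one_smul _ _
    · calc (r + 1)⁻¹ • ((r • a) ⊓ y) ≤ (r + 1)⁻¹ • y :=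
            smul_le_smul_of_nonneg_left inf_le_right (inv_nonneg.2 hr1.le)
        _ ≤ (1 : ℝ) • y := smul_le_smul_of_nonneg_right (inv_le_one_of_one_le₀ (by linarith)) hy
        _ = y := one_smul _ _
  calc (r • a) ⊓ y = (r + 1) • ((r + 1)⁻¹ • ((r • a) ⊓ y)) := by
        rw [smul_smul, mul_inv_cancel₀ hr1.ne', one_smul]
    _ ≤ _ := smul_le_smul_of_nonneg_left ht hr1.le

variable {M : E →L[ℝ] E}

theorem map_mono_of_nonneg (hM : ∀ x, 0 ≤ x → 0 ≤ M x) {x y : E} (h : x ≤ y) : M x ≤ M y := by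
  have := hM _ (sub_nonneg.2 h)
  rwa [map_sub, sub_nonneg] at this

/-- The vectors `a` for which `|a| ⊓ y` is annihilated by the positive operator `M`. -/
def disjointSubmodule (M : E →L[ℝ] E) (hM : ∀ x, 0 ≤ x → 0 ≤ M x) {y : E} (hy : 0 ≤ y) :
    Submodule ℝ E where
  carrier := {a | M (|a| ⊓ y) = 0}
  zero_mem' := by simp [hy]
  add_mem' := by
    intro a b ha hb
    refine le_antisymm ?_ (hM _ (le_inf (abs_nonneg _) hy))
    have h : |a + b| ⊓ y ≤ |a| ⊓ y + |b| ⊓ y :=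
      (inf_le_inf_right y (abs_add_le a b)).trans
        (add_inf_le_inf_add_inf (abs_nonneg a) (abs_nonneg b) hy)
    refine (map_mono_of_nonneg hM h).trans_eq ?_
    rw [map_add, show M (|a| ⊓ y) = 0 from ha, show M (|b| ⊓ y) = 0 from hb, add_zero]
  smul_mem' := by
    intro c a ha
    refine le_antisymm ?_ (hM _ (le_inf (abs_nonneg _) hy))
    have h : |c • a| ⊓ y ≤ (|c| + 1) • (|a| ⊓ y) :=
      (inf_le_inf_right y (abs_smul_le_abs_smul_abs c a)).trans
        (smul_inf_le_smul_inf (abs_nonneg c) (abs_nonneg a) hy)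
    refine (map_mono_of_nonneg hM h).trans_eq ?_
    rw [map_smul, show M (|a| ⊓ y) = 0 from ha, smul_zero]

theorem mem_disjointSubmodule {hM : ∀ x, 0 ≤ x → 0 ≤ M x} {y : E} {hy : 0 ≤ y} {a : E} :
    a ∈ disjointSubmodule M hM hy ↔ M (|a| ⊓ y) = 0 := Iff.rfl

theorem disjointSubmodule_solid {hM : ∀ x, 0 ≤ x → 0 ≤ M x} {y : E} {hy : 0 ≤ y} {a b : E}
    (hb : b ∈ disjointSubmodule M hM hy) (h : |a| ≤ |b|) : a ∈ disjointSubmodule M hM hy :=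
  le_antisymm ((map_mono_of_nonneg hM (inf_le_inf_right y h)).trans_eq hb)
    (hM _ (le_inf (abs_nonneg _) hy))

theorem isClosed_disjointSubmodule {hM : ∀ x, 0 ≤ x → 0 ≤ M x} {y : E} {hy : 0 ≤ y} :
    IsClosed (disjointSubmodule M hM hy : Set E) := by
  have : Continuous fun a : E => |a| :=
    (LipschitzWith.of_dist_le_mul (K := 1) fun a b => by
      simpa [dist_eq_norm] using norm_abs_sub_abs a b).continuous
  exact isClosed_eq (M.continuous.comp (this.inf continuous_const)) continuous_const

/-- The integral is the interval length times a mean value, and mean values stay in a closed convex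
set. -/
theorem Submodule.intervalIntegral_mem {F : Type*} [NormedAddCommGroup F] [NormedSpace ℝ F]
    [CompleteSpace F] (D : Submodule ℝ F) (hD : IsClosed (D : Set F)) {f : ℝ → F} {a b : ℝ}
    (hab : a ≤ b) (hf : Continuous f) (h : ∀ x ∈ Icc a b, f x ∈ D) : (∫ x in a..b, f x) ∈ D := by
  rcases hab.eq_or_lt with rfl | hlt
  · simp
  have hav := D.convex.set_average_mem hD (μ := MeasureTheory.volume) (t := Ioc a b) (f := f)
    (by simp [hlt]) (by simp)
    ((MeasureTheory.ae_restrict_iff' measurableSet_Ioc).2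
      (Eventually.of_forall fun x hx => h x (Ioc_subset_Icc_self hx)))
    (hf.integrableOn_Ioc)
  rw [MeasureTheory.setAverage_eq] at hav
  rw [intervalIntegral.integral_of_le hab]
  refine (D.smul_mem_iff (inv_ne_zero ?_)).1 hav
  simp [MeasureTheory.measureReal_def, hlt.le, (sub_pos.2 hlt).ne']

theorem intervalIntegral_mono_of_continuous [CompleteSpace E] {f g : ℝ → E} {a b : ℝ} (hab : a ≤ b)
    (hf : Continuous f) (hg : Continuous g) (h : ∀ x ∈ Icc a b, f x ≤ g x) :
    ∫ x in a..b, f x ≤ ∫ x in a..b, g x := by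
  rw [intervalIntegral.integral_of_le hab, intervalIntegral.integral_of_le hab]
  exact MeasureTheory.setIntegral_mono_on hf.integrableOn_Ioc hg.integrableOn_Ioc measurableSet_Ioc
    fun x hx => h x (Ioc_subset_Icc_self hx)

/-- A Fourier coefficient of a positive function which is, relative to the order of the range of
`M`, concentrated near `0` in comparison with its value at `0`, does not vanish. -/
theorem integral_cos_smul_ne_zero [CompleteSpace E] (hM : ∀ x, 0 ≤ x → 0 ≤ M x) {f : ℝ → E}
    (hf : Continuous f) (hpos : ∀ φ, 0 ≤ f φ) (hfix : M (f 0) = f 0) (h0 : f 0 ≠ 0) {n δ : ℝ}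
    (hδ : 0 < δ) (hδπ : δ ≤ Real.pi) (hn : ∀ φ, |φ| ≤ δ → 1 / 2 ≤ Real.cos (n * φ))
    (hdisj : ∀ φ, δ ≤ |φ| → |φ| ≤ Real.pi → M (f φ ⊓ f 0) = 0) :
    ∫ φ in (-Real.pi)..Real.pi, Real.cos (n * φ) • f φ ≠ 0 := by
  intro hz
  set D := disjointSubmodule M hM (hpos 0) with hD
  have hDc : IsClosed (D : Set E) := isClosed_disjointSubmodule
  have hcont : Continuous fun φ => Real.cos (n * φ) • f φ := by fun_prop
  have hint : ∀ a b, IntervalIntegrable (fun φ => Real.cos (n * φ) • f φ)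
      MeasureTheory.volume a b := fun a b => hcont.intervalIntegrable a b
  have hfar : ∀ φ, δ ≤ |φ| → |φ| ≤ Real.pi → Real.cos (n * φ) • f φ ∈ D := fun φ h1 h2 =>
    D.smul_mem _ (by
      rw [hD, mem_disjointSubmodule, abs_of_nonneg (hpos φ)]
      exact hdisj φ h1 h2)
  have hl : (∫ φ in (-Real.pi)..(-δ), Real.cos (n * φ) • f φ) ∈ D :=
    D.intervalIntegral_mem hDc (by linarith) hcont fun φ hφ => by
      have : |φ| = -φ := abs_of_nonpos (by linarith [hφ.2])
      exact hfar φ (by rw [this]; linarith [hφ.2]) (by rw [this]; linarith [hφ.1])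
  have hr : (∫ φ in δ..Real.pi, Real.cos (n * φ) • f φ) ∈ D :=
    D.intervalIntegral_mem hDc hδπ hcont fun φ hφ => by
      have : |φ| = φ := abs_of_nonneg (by linarith [hφ.1])
      exact hfar φ (by rw [this]; exact hφ.1) (by rw [this]; exact hφ.2)
  -- If the whole integral vanishes, its central part is minus the sum of the two tails, which lie
  -- in `D`.
  have hv : (∫ φ in (-δ)..δ, Real.cos (n * φ) • f φ) ∈ D := by
    rw [← intervalIntegral.integral_add_adjacent_intervals (hint _ (-δ)) (hint (-δ) _),
      ← intervalIntegral.integral_add_adjacent_intervals (hint (-δ) δ) (hint δ _)] at hz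
    rw [add_left_comm, ← eq_neg_iff_add_eq_zero] at hz
    rw [hz]
    exact D.neg_mem (D.add_mem hl hr)
  have hnn : ∀ φ, |φ| ≤ δ → 0 ≤ Real.cos (n * φ) • f φ := fun φ hφ =>
    smul_nonneg (by linarith [hn φ hφ]) (hpos φ)
  have hIpos : ∀ a b, a ≤ b → -δ ≤ a → b ≤ δ → 0 ≤ ∫ φ in a..b, Real.cos (n * φ) • f φ :=
    fun a b hab ha hb => by
      simpa using intervalIntegral_mono_of_continuous hab (continuous_const (y := (0 : E))) hcont
        fun φ hφ => hnn φ (abs_le.2 ⟨ha.trans hφ.1, hφ.2.trans hb⟩)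
  -- Near `0` the cosine is at least `1/2`, so half the integral of `f` over `[0, ε]` is dominated
  -- by the central integral. Solidity of `D` then applies, and the means over `[0, ε]` tend to `f
  -- 0`.
  have hsmall : ∀ ε, 0 < ε → ε ≤ δ → ε⁻¹ • ∫ φ in (0 : ℝ)..ε, f φ ∈ D := by
    intro ε hε hεδ
    refine D.smul_mem _ ((D.smul_mem_iff (show (1 / 2 : ℝ) ≠ 0 by norm_num)).1
      (disjointSubmodule_solid hv ?_))
    have h1 : (1 / 2 : ℝ) • ∫ φ in (0 : ℝ)..ε, f φ ≤
        ∫ φ in (0 : ℝ)..ε, Real.cos (n * φ) • f φ := by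
      rw [← intervalIntegral.integral_smul]
      refine intervalIntegral_mono_of_continuous hε.le (by fun_prop) hcont fun φ hφ => ?_
      refine smul_le_smul_of_nonneg_right (hn φ ?_) (hpos φ)
      rw [abs_of_nonneg hφ.1]; exact hφ.2.trans hεδ
    have h2 : ∫ φ in (0 : ℝ)..ε, Real.cos (n * φ) • f φ ≤
        ∫ φ in (-δ)..δ, Real.cos (n * φ) • f φ := by
      rw [← intervalIntegral.integral_add_adjacent_intervals (hint (-δ) 0) (hint 0 δ),
        ← intervalIntegral.integral_add_adjacent_intervals (hint 0 ε) (hint ε δ)]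
      exact le_add_of_nonneg_of_le (hIpos _ _ (by linarith) le_rfl hδ.le)
        (le_add_of_nonneg_right (hIpos _ _ hεδ (by linarith) le_rfl))
    have h3 : 0 ≤ ∫ φ in (0 : ℝ)..ε, f φ := by
      simpa using intervalIntegral_mono_of_continuous hε.le (continuous_const (y := (0 : E))) hf
        fun φ _ => hpos φ
    rw [abs_of_nonneg (smul_nonneg (by norm_num) h3),
      abs_of_nonneg (hIpos _ _ (by linarith) le_rfl le_rfl)]
    exact h1.trans h2
  have hlim : Tendsto (fun ε : ℝ => ε⁻¹ • ∫ φ in (0 : ℝ)..ε, f φ) (𝓝[>] 0) (𝓝 (f 0)) := by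
    have := (intervalIntegral.integral_hasDerivAt_right (hf.intervalIntegrable 0 0)
      (hf.stronglyMeasurableAtFilter _ _) hf.continuousAt).tendsto_slope_zero_right
    simpa using this
  have hmem : f 0 ∈ D := hDc.mem_of_tendsto hlim (by
    filter_upwards [Ioc_mem_nhdsGT hδ] with ε hε using hsmall ε hε.1 hε.2)
  rw [hD, mem_disjointSubmodule, abs_of_nonneg (hpos 0), inf_idem, hfix] at hmem
  exact h0 hmem

/-- In the lattice structure of the range of `M`, the positive part of `p` lies below the negative
part of `q`, which is disjoint from the positive part of `q`. -/
theorem map_inf_map_posPart_eq_zero (hM : ∀ x, 0 ≤ x → 0 ≤ M x) (hMM : ∀ x, M (M x) = M x)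
    {p q : E} (hq : M q = q) (hpq : p ≤ -q) : M (M p⁺ ⊓ M q⁺) = 0 := by
  have hneg : M p⁺ ≤ M q⁻ := map_mono_of_nonneg hM (by
    rw [← posPart_neg]; exact posPart_mono hpq)
  have hnn : 0 ≤ M p⁺ ⊓ M q⁺ := le_inf (hM _ (posPart_nonneg p)) (hM _ (posPart_nonneg q))
  set d := M (M p⁺ ⊓ M q⁺) with hd
  have h1 : d ≤ M p⁺ := (map_mono_of_nonneg hM inf_le_left).trans_eq (hMM _)
  have h2 : d ≤ M q⁺ := (map_mono_of_nonneg hM inf_le_right).trans_eq (hMM _)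
  have hq' : q = M q⁺ - M q⁻ := by rw [← map_sub, posPart_sub_negPart, hq]
  -- As `d` lies below both `M q⁺` and `M q⁻`, the vector `M q⁺ - d` dominates `0` and `q`. Applying
  -- `M` then yields `d ≤ 0`.
  have h3 : q⁺ ≤ M q⁺ - d := by
    refine sup_le ?_ (sub_nonneg.2 h2)
    calc q = M q⁺ - M q⁻ := hq'
      _ ≤ M q⁺ - d := sub_le_sub_left (h1.trans hneg) _
  have h4 := map_mono_of_nonneg hM h3
  rw [map_sub, hMM, show M d = d from hMM _] at h4
  exact le_antisymm (by simpa using h4) (hM _ hnn)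

/-- Operators which are positive and invertible on the range of `M` commute with the positive part
of the range of `M`. -/
theorem map_map_posPart_of_inverse {V W : E → E} (hM : ∀ x, 0 ≤ x → 0 ≤ M x)
    (hMM : ∀ x, M (M x) = M x) (hVM : ∀ x, M x = x → M (V x) = V x)
    (hWM : ∀ x, M x = x → M (W x) = W x)
    (hV : ∀ x y, M x = x → M y = y → x ≤ y → V x ≤ V y)
    (hW : ∀ x y, M x = x → M y = y → x ≤ y → W x ≤ W y)
    (hV0 : V 0 = 0) (hW0 : W 0 = 0)
    (hVW : ∀ x, M x = x → V (W x) = x) (hWV : ∀ x, M x = x → W (V x) = x) {p : E}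
    (hp : M p = p) : V (M p⁺) = M (V p)⁺ := by
  -- One inequality needs only that `V` is monotone. The other is this inequality for the inverse
  -- `W`, transported back by `V`.
  have key : ∀ (V : E → E), (∀ x, M x = x → M (V x) = V x) →
      (∀ x y, M x = x → M y = y → x ≤ y → V x ≤ V y) → V 0 = 0 → ∀ p, M p = p →
      M (V p)⁺ ≤ V (M p⁺) := by
    intro V hVM hV hV0 p hp
    rw [← hVM _ (hMM p⁺)]
    refine map_mono_of_nonneg hM (sup_le (hV _ _ hp (hMM _) ?_) ?_)
    · nth_rewrite 1 [← hp]
      exact map_mono_of_nonneg hM (le_posPart p)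
    · rw [← hV0]
      exact hV _ _ (map_zero M) (hMM _) (hM _ (posPart_nonneg p))
  refine le_antisymm ?_ (key V hVM hV hV0 p hp)
  have h := key W hWM hW hW0 (V p) (hVM p hp)
  rw [hWV p hp] at h
  have h2 := hV _ _ (hMM _) (hWM _ (hMM _)) h
  rwa [hVW _ (hMM _)] at h2

end PositiveProjection

/-! ### The peak function of a vector fixed by a positive projection. -/

namespace Complexification

variable {E : Type*} [NormedAddCommGroup E] [Lattice E] [HasSolidNorm E] [IsOrderedAddMonoid E]
  [NormedSpace ℝ E] [IsOrderedModule ℝ E]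

theorem continuous_rotRe (z : Complexification E) : Continuous (rotRe z) := by
  unfold rotRe; fun_prop

theorem rotRe_periodic (z : Complexification E) : Function.Periodic (rotRe z) (2 * Real.pi) :=
  fun θ => by simp [rotRe]

theorem map_rotRe (V : E →ₗ[ℝ] E) (z : Complexification E) (θ : ℝ) :
    V (rotRe z θ) = rotRe ⟨V z.re, V z.im⟩ θ := by
  simp [rotRe]

theorem rotRe_add_rotRe (z : Complexification E) (θ φ : ℝ) :
    rotRe z θ + rotRe z φ = (2 * Real.cos ((θ - φ) / 2)) • rotRe z ((θ + φ) / 2) := by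
  simp only [rotRe, smul_add, smul_smul]
  have h1 := Real.cos_add_cos θ φ
  have h2 := Real.sin_add_sin θ φ
  rw [show 2 * Real.cos ((θ - φ) / 2) * Real.cos ((θ + φ) / 2) = Real.cos θ + Real.cos φ by
      rw [h1]; ring,
    show 2 * Real.cos ((θ - φ) / 2) * Real.sin ((θ + φ) / 2) = Real.sin θ + Real.sin φ by
      rw [h2]; ring]
  module

variable [CompleteSpace E]

theorem eq_zero_of_modulus_nonpos {z : Complexification E} (h : modulus z ≤ 0) : z = 0 := by
  rw [← norm_eq_zero, norm_def, le_antisymm h (modulus_nonneg z), norm_zero]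

variable {M : E →L[ℝ] E}

/-- The positive part of `Re (e^{-iφ} z) - c |z|` with respect to the range of the positive
projection `M`. -/
noncomputable def peak (M : E →L[ℝ] E) (z : Complexification E) (c φ : ℝ) : E :=
  M (rotRe z φ - c • M (modulus z))⁺

theorem continuous_peak (M : E →L[ℝ] E) (z : Complexification E) (c : ℝ) :
    Continuous (peak M z c) :=
  M.continuous.comp (continuous_posPart.comp ((continuous_rotRe z).sub continuous_const))

theorem peak_periodic (M : E →L[ℝ] E) (z : Complexification E) (c : ℝ) :
    Function.Periodic (peak M z c) (2 * Real.pi) := fun φ => by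
  simp only [peak, rotRe_periodic z φ]

theorem map_rotRe_of_fixed {z : Complexification E} (hre : M z.re = z.re) (him : M z.im = z.im)
    (φ : ℝ) : M (rotRe z φ) = rotRe z φ := by
  simp [rotRe, hre, him]

theorem modulus_le_map_modulus (hM : ∀ x, 0 ≤ x → 0 ≤ M x) {z : Complexification E}
    (hre : M z.re = z.re) (him : M z.im = z.im) : modulus z ≤ M (modulus z) :=
  modulus_le fun φ => by
    rw [← map_rotRe_of_fixed hre him]
    exact map_mono_of_nonneg hM (rotRe_le_modulus z φ)

/-- If every peak vanished, `c M|z|` would bound all rotated real parts and hence `|z|`. Applying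
`M` gives `M|z| ≤ c M|z|`, which forces `|z| ≤ M|z| ≤ 0`. -/
theorem exists_peak_ne_zero (hM : ∀ x, 0 ≤ x → 0 ≤ M x) (hMM : ∀ x, M (M x) = M x)
    {z : Complexification E} (hre : M z.re = z.re) (him : M z.im = z.im) (hz : z ≠ 0) {c : ℝ}
    (hc : c < 1) : ∃ φ, peak M z c φ ≠ 0 := by
  by_contra! h
  have h1 : modulus z ≤ c • M (modulus z) := modulus_le fun φ => by
    have h2 := map_mono_of_nonneg hM (le_posPart (rotRe z φ - c • M (modulus z)))
    rw [show M (rotRe z φ - c • M (modulus z))⁺ = 0 from h φ, map_sub, map_smul, hMM,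
      map_rotRe_of_fixed hre him] at h2
    exact sub_nonpos.1 h2
  have h3 := map_mono_of_nonneg hM h1
  rw [map_smul, hMM] at h3
  have h4 : (1 - c) • M (modulus z) ≤ (1 - c) • (0 : E) := by
    rw [sub_smul, one_smul, smul_zero]; exact sub_nonpos.2 h3
  exact hz (eq_zero_of_modulus_nonpos ((modulus_le_map_modulus hM hre him).trans
    (le_of_smul_le_smul_left h4 (sub_pos.2 hc))))

/-- By sum-to-product, the real parts of `z` rotated by `θ` and `φ` add up to at most `2c M|z|`.
After subtracting `c M|z|` from each, their sum is at most zero, as `map_inf_map_posPart_eq_zero`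
requires. -/
theorem map_peak_inf_peak_eq_zero (hM : ∀ x, 0 ≤ x → 0 ≤ M x) (hMM : ∀ x, M (M x) = M x)
    {z : Complexification E} (hre : M z.re = z.re) (him : M z.im = z.im) {c θ φ : ℝ}
    (hc : |Real.cos ((θ - φ) / 2)| ≤ c) : M (peak M z c θ ⊓ peak M z c φ) = 0 := by
  refine map_inf_map_posPart_eq_zero hM hMM ?_ ?_
  · rw [map_sub, map_smul, hMM, map_rotRe_of_fixed hre him]
  · have h : rotRe z θ + rotRe z φ ≤ (2 * c) • M (modulus z) := by
      rw [rotRe_add_rotRe]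
      calc _ ≤ |2 * Real.cos ((θ - φ) / 2)| • |rotRe z ((θ + φ) / 2)| := smul_le_abs_smul_abs _ _
        _ ≤ |2 * Real.cos ((θ - φ) / 2)| • M (modulus z) :=
            smul_le_smul_of_nonneg_left ((abs_rotRe_le_modulus z _).trans
              (modulus_le_map_modulus hM hre him)) (abs_nonneg _)
        _ ≤ (2 * c) • M (modulus z) := by
            refine smul_le_smul_of_nonneg_right ?_ (hM _ (modulus_nonneg z))
            rw [abs_mul, abs_two]
            linarith
    rw [← sub_nonneg] at h ⊢
    convert h using 1
    module

/-- All ingredients of the peak are invariant except the angle: `V` commutes with positive parts in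
the range of `M` and fixes `M|z|`. -/
theorem apply_peak {V W : E →ₗ[ℝ] E} (hM : ∀ x, 0 ≤ x → 0 ≤ M x)
    (hMM : ∀ x, M (M x) = M x) (hVM : ∀ x, M x = x → M (V x) = V x)
    (hWM : ∀ x, M x = x → M (W x) = W x)
    (hV : ∀ x, M x = x → 0 ≤ x → 0 ≤ V x) (hW : ∀ x, M x = x → 0 ≤ x → 0 ≤ W x)
    (hVW : ∀ x, M x = x → V (W x) = x) (hWV : ∀ x, M x = x → W (V x) = x)
    {z : Complexification E} (hre : M z.re = z.re) (him : M z.im = z.im) {s : ℝ}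
    (hVz : ∀ φ, V (rotRe z φ) = rotRe z (φ - s)) (c φ : ℝ) :
    V (peak M z c φ) = peak M z c (φ - s) := by
  have mono : ∀ V : E →ₗ[ℝ] E, (∀ x, M x = x → 0 ≤ x → 0 ≤ V x) →
      ∀ x y, M x = x → M y = y → x ≤ y → V x ≤ V y := fun V hV x y hx hy h => by
    have := hV (y - x) (by rw [map_sub, hx, hy]) (sub_nonneg.2 h)
    rwa [map_sub, sub_nonneg] at this
  have hWz : ∀ φ, W (rotRe z φ) = rotRe z (φ + s) := fun φ => by
    rw [← hWV _ (map_rotRe_of_fixed hre him (φ + s)), hVz, add_sub_cancel_right]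
  -- A positive map that permutes the rotated real parts sends the upper bound `M|z|` to another
  -- upper bound. Using this for both `V` and `W` gives equality.
  have hle : ∀ (V : E →ₗ[ℝ] E) (r : ℝ), (∀ x, M x = x → M (V x) = V x) →
      (∀ x, M x = x → 0 ≤ x → 0 ≤ V x) → (∀ φ, V (rotRe z φ) = rotRe z (φ + r)) →
      M (modulus z) ≤ V (M (modulus z)) := fun V r hVM hV hVz => by
    rw [← hVM _ (hMM _)]
    refine map_mono_of_nonneg hM (modulus_le fun φ => ?_)
    have h := mono V hV _ _ (map_rotRe_of_fixed hre him (φ - r)) (hMM (modulus z))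
      ((rotRe_le_modulus z (φ - r)).trans (modulus_le_map_modulus hM hre him))
    rwa [hVz, sub_add_cancel] at h
  have hm : V (M (modulus z)) = M (modulus z) := by
    refine le_antisymm ?_ (hle V (-s) hVM hV fun φ => by rw [hVz, sub_eq_add_neg])
    have h := mono V hV _ _ (hMM _) (hWM _ (hMM _)) (hle W s hWM hW hWz)
    rwa [hVW _ (hMM _)] at h
  rw [peak, map_map_posPart_of_inverse hM hMM hVM hWM (mono V hV) (mono W hW) (map_zero V)
    (map_zero W) hVW hWV, map_sub, map_smul, hm, hVz, peak]
  rw [map_sub, map_smul, hMM, map_rotRe_of_fixed hre him]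

end Complexification

/-! ### The positive cone and real parts of operators. -/

namespace Complexification

variable {E : Type*} [NormedAddCommGroup E] [Lattice E] [HasSolidNorm E] [IsOrderedAddMonoid E]
  [NormedSpace ℝ E] [IsOrderedModule ℝ E]

theorem nonneg_iff {z : Complexification E} : 0 ≤ z ↔ 0 ≤ z.re ∧ z.im = 0 :=
  le_def.trans (and_congr_right fun _ => eq_comm)

theorem rotRe_exp_smul (z : Complexification E) (s φ : ℝ) :
    rotRe (Complex.exp (Complex.I * s) • z) φ = rotRe z (φ - s) := by
  have hre : (Complex.exp (Complex.I * s)).re = Real.cos s := by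
    rw [mul_comm, Complex.exp_ofReal_mul_I_re]
  have him : (Complex.exp (Complex.I * s)).im = Real.sin s := by
    rw [mul_comm, Complex.exp_ofReal_mul_I_im]
  simp only [rotRe, smul_re, smul_im, hre, him, Real.cos_sub, Real.sin_sub]
  module

variable [CompleteSpace E]

theorem real_smul_re (r : ℝ) (z : Complexification E) : (r • z).re = r • z.re := by
  change ((r : ℂ) • z).re = _
  rw [smul_re]; simp

theorem real_smul_im (r : ℝ) (z : Complexification E) : (r • z).im = r • z.im := by
  change ((r : ℂ) • z).im = _
  rw [smul_im]; simp

variable (E) in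
/-- The real part as a continuous linear map. -/
noncomputable def reCLM : Complexification E →L[ℝ] E :=
  LinearMap.mkContinuous
    { toFun := re
      map_add' := fun _ _ => rfl
      map_smul' := real_smul_re } 1 fun z => by rw [one_mul]; exact norm_re_le z

variable (E) in
/-- The embedding of `E` into its complexification as a continuous linear map. -/
noncomputable def ofRealCLM : E →L[ℝ] Complexification E :=
  LinearMap.mkContinuous
    { toFun := fun x => ⟨x, 0⟩
      map_add' := fun x y => by ext <;> simp
      map_smul' := fun r x => by ext <;> simp [real_smul_re, real_smul_im] } 1 fun x => by
        simpa using norm_le_add (⟨x, 0⟩ : Complexification E)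

@[simp] theorem reCLM_apply (z : Complexification E) : reCLM E z = z.re := rfl
@[simp] theorem ofRealCLM_re (x : E) : (ofRealCLM E x).re = x := rfl
@[simp] theorem ofRealCLM_im (x : E) : (ofRealCLM E x).im = 0 := rfl

theorem ofRealCLM_nonneg {x : E} (hx : 0 ≤ x) : 0 ≤ ofRealCLM E x := nonneg_iff.2 ⟨hx, rfl⟩

theorem ofRealCLM_re_of_im_eq_zero {z : Complexification E} (hz : z.im = 0) :
    ofRealCLM E z.re = z := by
  ext <;> simp [hz]

theorem eq_ofRealCLM_add (z : Complexification E) :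
    z = ofRealCLM E z.re + Complex.I • ofRealCLM E z.im := by
  ext <;> simp

theorem isClosed_nonneg : IsClosed {z : Complexification E | 0 ≤ z} := by
  simp only [nonneg_iff]
  exact (isClosed_le continuous_const lipschitzWith_re.continuous).inter
    (isClosed_eq lipschitzWith_im.continuous continuous_const)

theorem convex_nonneg : Convex ℝ {z : Complexification E | 0 ≤ z} := by
  intro z hz w hw a b ha hb _
  have hz := nonneg_iff.1 hz
  have hw := nonneg_iff.1 hw
  refine nonneg_iff.2 ⟨?_, ?_⟩
  · rw [add_re, real_smul_re, real_smul_re]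
    exact add_nonneg (smul_nonneg ha hz.1) (smul_nonneg hb hw.1)
  · simp [real_smul_im, hz.2, hw.2]

/-- The operator `Re ∘ L` on the real part. -/
noncomputable def realPart (L : Complexification E →L[ℂ] Complexification E) : E →L[ℝ] E :=
  (reCLM E).comp ((L.restrictScalars ℝ).comp (ofRealCLM E))

theorem realPart_apply (L : Complexification E →L[ℂ] Complexification E) (x : E) :
    realPart L x = (L (ofRealCLM E x)).re := rfl

/-- Positivity is asked only at two vectors, because the semigroup operators are known to be
positive only on the range of the projection. There `M x⁺` and `M x⁻` serve as `a` and `b`. -/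
theorem ofRealCLM_realPart {L : Complexification E →L[ℂ] Complexification E} {a b x : E}
    (ha : 0 ≤ L (ofRealCLM E a)) (hb : 0 ≤ L (ofRealCLM E b)) (hx : x = a - b) :
    ofRealCLM E (realPart L x) = L (ofRealCLM E x) := by
  have h : L (ofRealCLM E x) = L (ofRealCLM E a) - L (ofRealCLM E b) := by
    rw [hx, map_sub, map_sub]
  refine ofRealCLM_re_of_im_eq_zero (z := L (ofRealCLM E x)) ?_
  rw [h, sub_im, (nonneg_iff.1 ha).2, (nonneg_iff.1 hb).2, sub_zero]

end Complexification

/-! ### Operators increasing strongly to the identity. -/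

namespace IncreasesStronglyToId

open Complexification

variable {E : Type*} [NormedAddCommGroup E] [Lattice E] [HasSolidNorm E] [IsOrderedAddMonoid E]
  [NormedSpace ℝ E] [IsOrderedModule ℝ E] [CompleteSpace E]
  {P : ℕ → Complexification E →ₗ[ℂ] Complexification E}

theorem re_le (hP : IncreasesStronglyToId P) (n : ℕ) {f : Complexification E} (hf : 0 ≤ f) :
    (P n f).re ≤ f.re :=
  (monotone_nat_of_le_succ fun k => (hP.mono k f hf).1).ge_of_tendsto
    ((lipschitzWith_re.continuous.tendsto f).comp (hP.tendsto f)) n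

theorem norm_apply_ofReal_le (hP : IncreasesStronglyToId P) (n : ℕ) (x : E) :
    ‖P n (ofRealCLM E x)‖ ≤ 2 * ‖x‖ := by
  have key : ∀ a : E, 0 ≤ a → a ≤ |x| → ‖P n (ofRealCLM E a)‖ ≤ ‖x‖ := fun a ha hax => by
    have h := nonneg_iff.1 (hP.pos n _ (ofRealCLM_nonneg ha))
    refine (norm_le_add _).trans ?_
    rw [h.2, norm_zero, add_zero, ← norm_abs_eq_norm x]
    exact norm_le_norm_of_le h.1 ((hP.re_le n (ofRealCLM_nonneg ha)).trans hax)
  have hx : P n (ofRealCLM E x) = P n (ofRealCLM E x⁺) - P n (ofRealCLM E x⁻) := by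
    rw [← map_sub, ← map_sub, posPart_sub_negPart]
  rw [hx, two_mul]
  refine (norm_sub_le _ _).trans (add_le_add (key _ (posPart_nonneg x) ?_)
    (key _ (negPart_nonneg x) ?_))
  · exact sup_le (le_abs_self x) (abs_nonneg x)
  · exact sup_le (neg_le_abs x) (abs_nonneg x)

/-- Boundedness is not assumed: it follows from `0 ≤ P n f ≤ f` on the cone. The constant counts
positive and negative parts of the real and imaginary parts. -/
theorem continuous (hP : IncreasesStronglyToId P) (n : ℕ) : Continuous (P n) := by
  refine AddMonoidHomClass.continuous_of_bound (P n) 4 fun z => ?_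
  have h1 := hP.norm_apply_ofReal_le n z.re
  have h2 := hP.norm_apply_ofReal_le n z.im
  have hz : P n z = P n (ofRealCLM E z.re) + Complex.I • P n (ofRealCLM E z.im) := by
    rw [← map_smul, ← map_add, ← eq_ofRealCLM_add]
  rw [hz]
  refine (norm_add_le _ _).trans ?_
  rw [norm_smul, Complex.norm_I, one_mul]
  linarith [norm_re_le z, norm_im_le z]

theorem nonneg_of_forall_nonneg (hP : IncreasesStronglyToId P) {z : Complexification E}
    (h : ∀ n, 0 ≤ P n z) : 0 ≤ z :=
  isClosed_nonneg.mem_of_tendsto (hP.tendsto z) (Eventually.of_forall h)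

end IncreasesStronglyToId

/-! ### Local eventual positivity and eigenvectors for multiples of an eigenvalue. -/

section Cyclic

open Complexification

variable {E : Type*} [NormedAddCommGroup E] [Lattice E] [HasSolidNorm E] [IsOrderedAddMonoid E]
  [NormedSpace ℝ E] [IsOrderedModule ℝ E] [CompleteSpace E]
  {P : ℕ → Complexification E →ₗ[ℂ] Complexification E} {S : C0Semigroup (Complexification E)}

theorem HasLEP.rescale (h : HasLEP S P) (ω : ℝ) : HasLEP (S.rescale ω) P := by
  intro n f hf hf0
  obtain ⟨τ, hτ, h⟩ := h n f hf hf0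
  refine ⟨τ, hτ, fun t ht => ?_⟩
  have h1 := nonneg_iff.1 (h t ht)
  have h2 : P n ((S.rescale ω).op t f) = Real.exp (-ω * t) • P n (S.op t f) := by
    rw [← Complex.coe_smul, ← map_smul]; rfl
  rw [h2, nonneg_iff, real_smul_re, real_smul_im, h1.2, smul_zero]
  exact ⟨smul_nonneg (Real.exp_pos _).le h1.1, rfl⟩

theorem HasLEP.eventually_nonneg (h : HasLEP S P) {p : ℝ≥0} (hp : 0 < p) (t : ℝ≥0) (n : ℕ)
    {f : Complexification E} (hf : 0 ≤ f) :
    ∀ᶠ k : ℕ in atTop, 0 ≤ P n (S.op (t + k • p) f) := by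
  by_cases hf0 : f = 0
  · simp [hf0]
  obtain ⟨τ, -, hτ⟩ := h n f hf hf0
  have : Tendsto (fun k : ℕ => k • p) atTop atTop := tendsto_id.atTop_nsmul_const hp
  filter_upwards [this.eventually_ge_atTop τ] with k hk
  exact hτ _ (hk.trans le_add_self)

/-- Since `f` is `p`-periodic, `S(t) f = S(t + kp) f` for every `k`. For each `n` a large `k` passes
the threshold time, which may depend on `n`. -/
theorem HasLEP.op_nonneg_of_periodic (h : HasLEP S P) (hP : IncreasesStronglyToId P) {p : ℝ≥0}
    (hp : 0 < p) {f : Complexification E} (hf : 0 ≤ f) (hpf : S.op p f = f) (t : ℝ≥0) :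
    0 ≤ S.op t f := by
  refine hP.nonneg_of_forall_nonneg fun n => ?_
  obtain ⟨k, hk⟩ := (h.eventually_nonneg hp t n hf).exists
  rwa [S.op_add, ContinuousLinearMap.comp_apply, S.op_nsmul_apply_of_fixed hpf] at hk

/-- If a semigroup acts on a periodic function `g` by translation, the Fourier coefficients of `g`
are eigenvectors. -/
theorem op_fourierCoeff_eq {g : ℝ → E} (hg : Continuous g)
    (hper : Function.Periodic g (2 * Real.pi)) {t : ℝ≥0} {s : ℝ}
    (h : ∀ φ, S.op t (ofRealCLM E (g φ)) = ofRealCLM E (g (φ - s))) (n : ℤ) :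
    S.op t (∫ φ in (-Real.pi)..Real.pi, Complex.exp (Complex.I * (n * φ : ℝ)) • ofRealCLM E (g φ)) =
      Complex.exp (Complex.I * (n * s : ℝ)) •
        ∫ φ in (-Real.pi)..Real.pi, Complex.exp (Complex.I * (n * φ : ℝ)) • ofRealCLM E (g φ) := by
  set G : ℝ → Complexification E := fun φ =>
    Complex.exp (Complex.I * (n * φ : ℝ)) • ofRealCLM E (g φ) with hG
  have hGc : Continuous G := by
    have := (ofRealCLM E).continuous.comp hg
    simp only [Function.comp_def] at this
    fun_prop
  have hGp : Function.Periodic G (2 * Real.pi) := fun φ => by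
    simp only [hG, hper φ]
    congr 1
    rw [Complex.exp_eq_exp_iff_exists_int]
    exact ⟨n, by push_cast; ring⟩
  have h1 : ∀ φ, S.op t (G φ) = Complex.exp (Complex.I * (n * s : ℝ)) • G (φ - s) := fun φ => by
    simp only [hG, map_smul, h, smul_smul, ← Complex.exp_add]
    congr 2
    push_cast; ring
  rw [← ContinuousLinearMap.intervalIntegral_comp_comm _ (hGc.intervalIntegrable _ _)]
  simp only [h1]
  rw [intervalIntegral.integral_smul, intervalIntegral.integral_comp_sub_right]
  have h2 := hGp.intervalIntegral_add_eq (-Real.pi - s) (-Real.pi)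
  rw [show -Real.pi - s + 2 * Real.pi = Real.pi - s by ring,
    show -Real.pi + 2 * Real.pi = Real.pi by ring] at h2
  rw [h2]

theorem fourierCoeff_re {g : ℝ → E} (hg : Continuous g) (n : ℤ) :
    (∫ φ in (-Real.pi)..Real.pi,
      Complex.exp (Complex.I * (n * φ : ℝ)) • ofRealCLM E (g φ)).re =
        ∫ φ in (-Real.pi)..Real.pi, Real.cos (n * φ) • g φ := by
  have hGc : Continuous fun φ : ℝ =>
      Complex.exp (Complex.I * (n * φ : ℝ)) • ofRealCLM E (g φ) := by
    have := (ofRealCLM E).continuous.comp hg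
    simp only [Function.comp_def] at this
    fun_prop
  rw [← reCLM_apply,
    ← ContinuousLinearMap.intervalIntegral_comp_comm _ (hGc.intervalIntegrable _ _)]
  congr 1
  ext φ
  rw [reCLM_apply, smul_re, ofRealCLM_im, ofRealCLM_re, smul_zero, sub_zero, mul_comm Complex.I,
    Complex.exp_ofReal_mul_I_re]

/-- The bound keeps `|nφ|` below `π/3`. The summand `1` avoids division by zero at `n = 0`. -/
theorem half_le_cos_of_abs_le {n φ : ℝ} (h : |φ| ≤ Real.pi / (3 * (|n| + 1))) :
    1 / 2 ≤ Real.cos (n * φ) := by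
  rw [← Real.cos_abs, ← Real.cos_pi_div_three]
  refine Real.cos_le_cos_of_nonneg_of_le_pi (abs_nonneg _) (by linarith [Real.pi_pos]) ?_
  rw [abs_mul]
  have h0 : 0 < |n| + 1 := by positivity
  calc |n| * |φ| ≤ (|n| + 1) * (Real.pi / (3 * (|n| + 1))) :=
        mul_le_mul (by linarith) h (abs_nonneg _) h0.le
    _ = Real.pi / 3 := by field_simp

/-- If a locally eventually positive semigroup with relatively compact orbits has a common
eigenvector with eigenvalues `e^{ibt}`, it has one with eigenvalues `e^{inbt}`. -/
theorem HasLEP.exists_eigenvector_int_mul (hLEP : HasLEP S P) (hP : IncreasesStronglyToId P)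
    (hS : S.HasRelativelyCompactOrbits) {z : Complexification E} (hz : z ≠ 0) {b : ℝ} (hb : b ≠ 0)
    (hSz : ∀ t : ℝ≥0, S.op t z = Complex.exp (Complex.I * (b * t : ℝ)) • z) (n : ℤ) :
    ∃ h : Complexification E, h ≠ 0 ∧
      ∀ t : ℝ≥0, S.op t h = Complex.exp (Complex.I * (n * (b * t) : ℝ)) • h := by
  obtain ⟨p, hp, hpb⟩ : ∃ p : ℝ≥0, 0 < p ∧ |b| * p = 2 * Real.pi := by
    have hb' : 0 < |b| := abs_pos.2 hb
    have hq : 0 < 2 * Real.pi / |b| := by positivity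
    exact ⟨⟨_, hq.le⟩, hq, mul_div_cancel₀ _ hb'.ne'⟩
  have hpz : S.op p z = z := by
    have : Complex.exp (Complex.I * (b * p : ℝ)) = 1 := by
      rw [Complex.exp_eq_one_iff]
      rcases abs_cases b with ⟨hb', -⟩ | ⟨hb', -⟩
      · refine ⟨1, ?_⟩
        rw [← hb', hpb]; push_cast; ring
      · refine ⟨-1, ?_⟩
        rw [← neg_neg b, ← hb', neg_mul, hpb]; push_cast; ring
    rw [hSz, this, one_smul]
  obtain ⟨L, hpL, hLfix, hLS, hLmem⟩ := S.exists_ergodic_projection hS p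
  -- For each `k` the set of `w` with `P k w ≥ 0` is closed and convex, and it contains all late
  -- terms of the orbit, hence also the ergodic limit.
  have hLpos : ∀ x : E, 0 ≤ x → 0 ≤ L (ofRealCLM E x) := fun x hx => by
    refine hP.nonneg_of_forall_nonneg fun k => ?_
    refine hLmem {w | 0 ≤ P k w} _ (isClosed_nonneg.preimage (hP.continuous k)) ?_ ?_
    · exact convex_nonneg.linear_preimage ((P k).restrictScalars ℝ)
    · simpa using hLEP.eventually_nonneg hp 0 k (ofRealCLM_nonneg hx)
  set M := realPart L with hMdef
  have hML : ∀ x, ofRealCLM E (M x) = L (ofRealCLM E x) := fun x =>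
    ofRealCLM_realPart (hLpos _ (posPart_nonneg x)) (hLpos _ (negPart_nonneg x))
      (posPart_sub_negPart x).symm
  have hM : ∀ x, 0 ≤ x → 0 ≤ M x := fun x hx => (nonneg_iff.1 (hLpos x hx)).1
  have hMfix : ∀ x, L (ofRealCLM E x) = ofRealCLM E x → M x = x := fun x hx => by
    rw [hMdef, realPart_apply, hx, ofRealCLM_re]
  have hper : ∀ x, M x = x → S.op p (ofRealCLM E x) = ofRealCLM E x := fun x hx => by
    rw [← hx, hML, hpL]
  have hMM : ∀ x, M (M x) = M x := fun x => hMfix _ (by rw [hML, hLfix _ (hpL _)])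
  have hpos : ∀ (t : ℝ≥0) x, M x = x → 0 ≤ x → 0 ≤ S.op t (ofRealCLM E x) := fun t x hx hx0 =>
    hLEP.op_nonneg_of_periodic hP hp (ofRealCLM_nonneg hx0) (hper x hx) t
  set V : ℝ≥0 → E →L[ℝ] E := fun t => realPart (S.op t) with hVdef
  have hVS : ∀ t x, M x = x → ofRealCLM E (V t x) = S.op t (ofRealCLM E x) := fun t x hx =>
    ofRealCLM_realPart (hpos t _ (hMM x⁺) (hM _ (posPart_nonneg x)))
      (hpos t _ (hMM x⁻) (hM _ (negPart_nonneg x)))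
      (by rw [← map_sub, posPart_sub_negPart, hx])
  have hVM : ∀ t x, M x = x → M (V t x) = V t x := fun t x hx => hMfix _ (by
    rw [hVS t x hx, ← hLS, ← hML, hx])
  have hVpos : ∀ t x, M x = x → 0 ≤ x → 0 ≤ V t x := fun t x hx hx0 =>
    (nonneg_iff.1 (hpos t x hx hx0)).1
  -- On the range of `M` the operator at time `kp - t` inverts the one at time `t`.
  have hVV : ∀ s t (k : ℕ), s + t = k • p → ∀ x, M x = x → V s (V t x) = x := by
    intro s t k hst x hx
    rw [hVdef]
    simp only
    rw [realPart_apply, show ofRealCLM E (realPart (S.op t) x) = _ from hVS t x hx,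
      ← ContinuousLinearMap.comp_apply, ← S.op_add, hst, S.op_nsmul_apply_of_fixed (hper x hx),
      ofRealCLM_re]
  have hsplit : ∀ (A : Complexification E →L[ℂ] Complexification E) (B : E → E),
      ofRealCLM E (B z.re) = A (ofRealCLM E z.re) → ofRealCLM E (B z.im) = A (ofRealCLM E z.im) →
        A z = ⟨B z.re, B z.im⟩ := fun A B h1 h2 => by
    conv_lhs => rw [eq_ofRealCLM_add z, map_add, map_smul, ← h1, ← h2]
    ext <;> simp
  have hMz := hsplit L M (hML _) (hML _)
  rw [hLfix z hpz] at hMz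
  have hre : M z.re = z.re := (congrArg re hMz).symm
  have him : M z.im = z.im := (congrArg im hMz).symm
  have hVz : ∀ t φ, V t (rotRe z φ) = rotRe z (φ - b * t) := fun t φ => by
    have h1 := map_rotRe (V t : E →ₗ[ℝ] E) z φ
    have h2 := hsplit (S.op t) (V t) (hVS t _ hre) (hVS t _ him)
    rw [hSz] at h2
    rw [← rotRe_exp_smul, h2]
    exact h1
  set δ := Real.pi / (3 * (|(n : ℝ)| + 1)) with hδ
  have hδ0 : 0 < δ := by positivity
  have hδπ : δ ≤ Real.pi := div_le_self Real.pi_pos.le (by linarith [abs_nonneg (n : ℝ)])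
  -- The threshold `cos (δ/2)` is chosen so that peaks at angular distance at least `δ` are
  -- disjoint.
  have hc : Real.cos (δ / 2) < 1 := by
    rw [← Real.cos_zero]
    exact Real.cos_lt_cos_of_nonneg_of_le_pi le_rfl (by linarith) (by linarith)
  obtain ⟨φ₀, hφ₀⟩ := exists_peak_ne_zero hM hMM hre him hz hc
  -- The shift by `φ₀` places a nonvanishing peak at angle `0`.
  set g : ℝ → E := fun φ => peak M z (Real.cos (δ / 2)) (φ + φ₀) with hg
  have hgc : Continuous g := (continuous_peak M z _).comp (continuous_add_const φ₀)
  have hgp : Function.Periodic g (2 * Real.pi) := (peak_periodic M z _).add_const φ₀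
  have hgM : ∀ φ, M (g φ) = g φ := fun φ => hMM _
  refine ⟨∫ φ in (-Real.pi)..Real.pi,
    Complex.exp (Complex.I * (n * φ : ℝ)) • ofRealCLM E (g φ), fun h0 => ?_, fun t => ?_⟩
  · refine integral_cos_smul_ne_zero hM hgc (fun φ => hM _ (posPart_nonneg _)) (hgM 0)
      (by simpa [hg] using hφ₀) hδ0 hδπ (fun φ hφ => half_le_cos_of_abs_le hφ) (fun φ h1 h2 => ?_)
      ((fourierCoeff_re hgc n).symm.trans (by rw [h0, zero_re]))
    refine map_peak_inf_peak_eq_zero hM hMM hre him ?_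
    -- For `|φ| ≤ π` the half angle stays within `[-π/2, π/2]`, so its cosine is nonnegative and
    -- decreases in `|φ|`.
    rw [show (φ + φ₀ - (0 + φ₀)) / 2 = φ / 2 by ring, ← Real.cos_abs, abs_div, abs_two,
      abs_of_nonneg (Real.cos_nonneg_of_neg_pi_div_two_le_of_le
        (by linarith [abs_nonneg φ, Real.pi_pos]) (by linarith))]
    exact Real.cos_le_cos_of_nonneg_of_le_pi (by linarith) (by linarith [Real.pi_pos])
      (by linarith)
  · refine op_fourierCoeff_eq hgc hgp (fun φ => ?_) n
    obtain ⟨k, hk⟩ : ∃ k : ℕ, t ≤ k • p :=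
      ((tendsto_id.atTop_nsmul_const hp).eventually_ge_atTop t).exists
    rw [← hVS t _ (hgM φ)]
    have h := apply_peak (V := (V t : E →ₗ[ℝ] E)) (W := (V (k • p - t) : E →ₗ[ℝ] E)) hM hMM
      (hVM t) (hVM _) (hVpos t) (hVpos _)
      (hVV _ _ k (add_tsub_cancel_of_le hk)) (hVV _ _ k (tsub_add_cancel_of_le hk)) hre him
      (hVz t) (Real.cos (δ / 2)) (φ + φ₀)
    rw [hg]
    simp only
    rw [show φ - b * t + φ₀ = φ + φ₀ - b * t by ring, ← h]
    rfl

end Cyclic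

/-! ### Cyclicity of the peripheral point spectrum. -/

theorem mainTheorem6 {E : Type*} [NormedAddCommGroup E] [Lattice E] [HasSolidNorm E]
    [IsOrderedAddMonoid E] [NormedSpace ℝ E] [IsOrderedModule ℝ E] [CompleteSpace E]
    (T : C0Semigroup (Complexification E))
    (hs : ⊥ < T.generator.spectralBound)
    (P : ℕ → Complexification E →ₗ[ℂ] Complexification E)
    (hP : IncreasesStronglyToId P)
    (hLEP : HasLEP T P)
    (hT : (T.rescale T.generator.spectralBound.toReal).HasRelativelyCompactOrbits) :
    IsCyclicSet T.generator.peripheralPointSpectrum := by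
  rintro a b ⟨⟨-, hre⟩, z, hz, hAz⟩ n
  have hre' : ∀ c : ℝ, ((a : ℂ) + Complex.I * c).re = a := fun c => by simp
  rw [hre'] at hre
  have hmem : (a : ℂ) + Complex.I * (n * b) ∈ T.generator.pointSpectrum := by
    -- For `b = 0` there is no period `2π/|b|`, but all multiples coincide with the given
    -- eigenvalue.
    rcases eq_or_ne b 0 with rfl | hb
    · exact ⟨z, hz, by simpa using hAz⟩
    rw [← hre, EReal.toReal_coe] at hT
    have hop : ∀ (t : ℝ≥0) (w : Complexification E),
        (T.rescale a).op t w = Complex.exp (-(a * (t : ℝ))) • T.op t w := fun t w => by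
      simp [C0Semigroup.rescale]
    obtain ⟨h, hh, hSh⟩ := (hLEP.rescale a).exists_eigenvector_int_mul hP hT hz hb (fun t => by
      rw [hop, T.op_eq_of_generator_eq z hAz, smul_smul, ← Complex.exp_add]
      congr 2
      push_cast; ring) n
    refine T.mem_pointSpectrum_of_op_eq hh fun t => ?_
    have h1 := hSh t
    rw [hop] at h1
    calc T.op t h = Complex.exp (a * (t : ℝ)) • Complex.exp (-(a * (t : ℝ))) • T.op t h := by
          rw [smul_smul, ← Complex.exp_add, add_neg_cancel, Complex.exp_zero, one_smul]
      _ = _ := by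
          rw [h1, smul_smul, ← Complex.exp_add]
          congr 2
          push_cast; ring
  refine ⟨⟨LinearPMap.pointSpectrum_subset_unboundedSpectrum _ hmem, ?_⟩, hmem⟩
  rw [← hre]
  have := hre' (n * b)
  push_cast at this
  rw [this]
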